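/- Identify $\mathbb{R}^3$ with the Lie algebra $\mathfrak{su}(2)$ by a linear isomorphism that carries the Euclidean norm $|\cdot|$ to an $\mathrm{Ad}$-invariant norm. Let $j(x)=\frac{\sin(\alpha(x)/2)}{\alpha(x)/2}$ be the analytic square root of the Jacobian of $\exp:\mathfrak{su}(2)\to SU(2)$ with $j(0)=1$, where $\alpha$ is the positive root (so $\alpha(x)/2=\theta$ if $x$ has eigenvalues $\pm i\theta$). The wrap of a finite measure $\nu$ on $\mathbb{R}^3\cong\mathfrak{su}(2)$ is the finite signed measure $\Phi(\nu)$ on $SU(2)$ given by $\langle\Phi(\nu),f\rangle=\langle\nu,\,j\cdot(f\circ\exp)\rangle$. For a probability measure $\mu$ on $[0,\infty)$, let $\Phi(\mu)$ be the wrap of the law on $\mathbb{R}^3$ of a vector whose length has law $\mu$ and whose direction is uniformly distributed and independent of the length (a random adjoint orbit). For probability measures $\mu,\nu$ on $[0,\infty)$, let $\mu*\nu$ be the law of the length of the sum of two independent such vectors with length laws $\mu$ and $\nu$. **Proposition.** Let $X,Y$ be independent spherically symmetric random vectors in $\mathbb{R}^3$, and let $\mu_X,\mu_Y$ be the laws of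 $|X|,|Y|$. Then the law of $|X+Y|$ is $\mu_X*\mu_Y$; the wrap to $SU(2)$ of the law of $|X+Y|$, which is also the wrap of the law of the vector $X+Y$, is $\Phi(\mu_X*\mu_Y)$; and $$\Phi(\mu_X*\mu_Y)=\Phi(\mu_X)*\Phi(\mu_Y),$$ where the convolution on the right is that of finite signed measures on $SU(2)$. In words, sums of random adjoint orbits wrap to products of random conjugacy classes. -/

import Mathlib

open MeasureTheory ProbabilityTheory
open scoped NNReal MeasureTheory

namespace SU2Wrapping

/-- Euclidean three-space. -/
abbrev E3 : Type := EuclideanSpace ℝ (Fin 3)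

/-! ### The group SU(2), its Lie algebra, and the exponential map -/

/-- The compact group of unitary `2 × 2` complex matrices of determinant one. -/
abbrev SU2 : Type := Matrix.specialUnitaryGroup (Fin 2) ℂ

/-- SU(2) carries its Borel σ-algebra. -/
noncomputable instance instMeasurableSpaceSU2 : MeasurableSpace SU2 := borel SU2

instance instBorelSpaceSU2 : BorelSpace SU2 := ⟨rfl⟩

instance instSecondCountableTopologySU2 : SecondCountableTopology SU2 :=
  have : SecondCountableTopology (Matrix (Fin 2) (Fin 2) ℂ) :=
    inferInstanceAs (SecondCountableTopology (Fin 2 → Fin 2 → ℂ))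
  TopologicalSpace.Subtype.secondCountableTopology
    (Matrix.specialUnitaryGroup (Fin 2) ℂ : Set (Matrix (Fin 2) (Fin 2) ℂ))

/-- The Lie algebra of SU(2): skew-Hermitian `2 × 2` complex matrices of trace zero. -/
noncomputable def su2 : Submodule ℝ (Matrix (Fin 2) (Fin 2) ℂ) where
  carrier := {X | star X = -X ∧ X.trace = 0}
  add_mem' := by
    rintro X Y ⟨hX, hX'⟩ ⟨hY, hY'⟩
    exact ⟨by rw [star_add, hX, hY, neg_add], by rw [Matrix.trace_add, hX', hY', add_zero]⟩
  zero_mem' := ⟨by simp, by simp⟩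
  smul_mem' := by
    rintro c X ⟨hX, hX'⟩
    exact ⟨by rw [star_smul, hX, star_trivial, smul_neg],
      by rw [Matrix.trace_smul, hX', smul_zero]⟩

theorem mem_su2 {X : Matrix (Fin 2) (Fin 2) ℂ} : X ∈ su2 ↔ star X = -X ∧ X.trace = 0 := Iff.rfl

/-- The adjoint action `X ↦ g X g⁻¹` of SU(2) on its Lie algebra. -/
noncomputable def Ad (g : SU2) (X : su2) : su2 :=
  ⟨(g : Matrix (Fin 2) (Fin 2) ℂ) * X * star (g : Matrix (Fin 2) (Fin 2) ℂ), by
    obtain ⟨X, hX, hX'⟩ := X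
    refine ⟨?_, ?_⟩
    · simp only [star_mul, star_star, hX, mul_assoc, neg_mul, mul_neg]
    · have hg : star (g : Matrix (Fin 2) (Fin 2) ℂ) * (g : Matrix (Fin 2) (Fin 2) ℂ) = 1 :=
        (Matrix.mem_unitaryGroup_iff'.1 (Matrix.mem_specialUnitaryGroup_iff.1 g.2).1)
      rw [Matrix.trace_mul_comm, ← mul_assoc, hg, one_mul]
      exact hX'⟩

theorem det_exp_eq_one {X : Matrix (Fin 2) (Fin 2) ℂ} (hX : X.trace = 0) :
    (NormedSpace.exp X).det = 1 := by
  have key : ∀ Z : Matrix (Fin 2) (Fin 2) ℂ, Z.trace = 0 → (NormedSpace.exp Z).det ^ 2 = 1 := by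
    intro Z hZ
    have hZ' : Z 1 1 = -Z 0 0 := by
      rw [Matrix.trace_fin_two] at hZ
      exact eq_neg_of_add_eq_zero_right hZ
    let J : Matrix (Fin 2) (Fin 2) ℂ := !![0, 1; -1, 0]
    have hJ : IsUnit J := by
      rw [Matrix.isUnit_iff_isUnit_det]
      simp [J]
    have hJd : IsUnit J.det := (Matrix.isUnit_iff_isUnit_det _).1 hJ
    have h1 : J * Z.transpose * J⁻¹ = -Z := by
      have h2 : J * Z.transpose = -Z * J := by
        ext i j
        fin_cases i <;> fin_cases j <;>
          simp [J, Matrix.mul_apply, Fin.sum_univ_two, hZ']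
      rw [h2, Matrix.mul_nonsing_inv_cancel_right _ _ hJd]
    have h3 := Matrix.exp_conj J Z.transpose hJ
    rw [h1, Matrix.exp_neg, Matrix.exp_transpose] at h3
    have h4 := congrArg Matrix.det h3
    rw [Matrix.det_conj hJ, Matrix.det_transpose] at h4
    have h5 : IsUnit (NormedSpace.exp Z).det :=
      (Matrix.isUnit_iff_isUnit_det _).1 (Matrix.isUnit_exp Z)
    have h6 : (NormedSpace.exp Z) * (NormedSpace.exp Z)⁻¹ = 1 := Matrix.mul_nonsing_inv _ h5
    have h7 := congrArg Matrix.det h6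
    rw [Matrix.det_mul, h4, Matrix.det_one] at h7
    rw [sq, h7]
  have h8 : (2 : ℕ) • ((1 / 2 : ℂ) • X) = X := by
    rw [← Nat.cast_smul_eq_nsmul ℂ, smul_smul]
    norm_num
  rw [← h8, Matrix.exp_nsmul, Matrix.det_pow]
  exact key _ (by rw [Matrix.trace_smul, hX, smul_zero])

theorem exp_mem_SU2 (X : su2) :
    NormedSpace.exp (X : Matrix (Fin 2) (Fin 2) ℂ) ∈ Matrix.specialUnitaryGroup (Fin 2) ℂ := by
  rw [Matrix.mem_specialUnitaryGroup_iff]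
  refine ⟨?_, det_exp_eq_one X.2.2⟩
  have h5 : IsUnit (NormedSpace.exp (X : Matrix (Fin 2) (Fin 2) ℂ)).det :=
    (Matrix.isUnit_iff_isUnit_det _).1 (Matrix.isUnit_exp _)
  rw [Matrix.mem_unitaryGroup_iff, Matrix.star_eq_conjTranspose, ← Matrix.exp_conjTranspose,
    ← Matrix.star_eq_conjTranspose, X.2.1, Matrix.exp_neg]
  exact Matrix.mul_nonsing_inv _ h5

/-- The exponential map from the Lie algebra to SU(2), given by the matrix exponential. -/
noncomputable def expSU2 (X : su2) : SU2 := ⟨NormedSpace.exp (X : Matrix (Fin 2) (Fin 2) ℂ),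
  exp_mem_SU2 X⟩

/-- The positive root, evaluated at the representative of `X` in the closed positive Weyl chamber:
`X` is conjugate to `diag (i θ, -i θ)` with `θ = √(det X) ≥ 0`, on which the root is `2 θ`. -/
noncomputable def posRoot (X : su2) : ℝ :=
  2 * Real.sqrt ((X : Matrix (Fin 2) (Fin 2) ℂ).det).re

/-- The analytic square root `j` of the Jacobian of the exponential map, with `j 0 = 1`: the
product over the positive roots `α` of `sin (α X / 2) / (α X / 2)`. For SU(2) there is just one
positive root. (`Real.sinc t = sin t / t`, and `Real.sinc 0 = 1`.) -/
noncomputable def jFun (X : su2) : ℝ := Real.sinc (posRoot X / 2)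

theorem continuous_expSU2 : Continuous expSU2 := by
  refine Continuous.subtype_mk ?_ _
  open scoped Matrix.Norms.Operator in
  exact NormedSpace.exp_continuous.comp continuous_subtype_val

theorem continuous_jFun : Continuous jFun := by
  unfold jFun posRoot
  refine Real.continuous_sinc.comp (Continuous.div_const (continuous_const.mul (Real.continuous_sqrt.comp
    (Complex.continuous_re.comp (Continuous.matrix_det continuous_subtype_val)))) _)

/-- A linear identification of Euclidean three-space with the Lie algebra of SU(2) that carries
the Euclidean norm to an Ad-invariant norm. -/
def IsAdInvariant (ι : E3 ≃ₗ[ℝ] su2) : Prop :=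
  ∀ (g : SU2) (x : E3), ‖ι.symm (Ad g (ι x))‖ = ‖x‖

/-! ### The wrapping map -/

/-- The wrap of a finite measure `ν` on `ℝ³ ≅ su(2)`: the finite signed measure `Φ(ν)` on SU(2)
with `⟨Φ(ν), f⟩ = ⟨ν, j · (f ∘ exp)⟩`, that is, the image under `exp` of the measure with
density `j` with respect to `ν`. It is signed because `j` takes negative values. -/
noncomputable def wrap (ι : E3 ≃ₗ[ℝ] su2) (ν : Measure E3) : SignedMeasure SU2 :=
  (ν.withDensityᵥ fun x => jFun (ι x)).map fun x => expSU2 (ι x)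

theorem measurable_exp_comp (ι : E3 ≃ₗ[ℝ] su2) : Measurable fun x => expSU2 (ι x) :=
  (continuous_expSU2.comp (LinearMap.continuous_of_finiteDimensional (ι : E3 →ₗ[ℝ] su2))).measurable

theorem integrable_jFun (ι : E3 ≃ₗ[ℝ] su2) (ν : Measure E3) [IsFiniteMeasure ν] :
    Integrable (fun x => jFun (ι x)) ν := by
  refine Integrable.of_bound (C := 1) ((continuous_jFun.comp
    (LinearMap.continuous_of_finiteDimensional (ι : E3 →ₗ[ℝ] su2))).aestronglyMeasurable) ?_
  exact Filter.Eventually.of_forall fun x => Real.abs_sinc_le_one _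

theorem wrap_apply (ι : E3 ≃ₗ[ℝ] su2) (ν : Measure E3) [IsFiniteMeasure ν] {s : Set SU2}
    (hs : MeasurableSet s) :
    wrap ι ν s = ∫ x in {x | expSU2 (ι x) ∈ s}, jFun (ι x) ∂ν := by
  rw [wrap, VectorMeasure.map_apply _ (measurable_exp_comp ι) hs,
    withDensityᵥ_apply (integrable_jFun ι ν) (measurable_exp_comp ι hs)]
  rfl

/-- The convolution of signed measures on SU(2): the image of the product under multiplication. -/
noncomputable def signedConv (α β : SignedMeasure SU2) : SignedMeasure SU2 :=
  (VectorMeasure.prod α β (ContinuousLinearMap.mul ℝ ℝ)).map fun p => p.1 * p.2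

theorem hasProd_mul (α β : SignedMeasure SU2) :
    VectorMeasure.HasProd α β (ContinuousLinearMap.mul ℝ ℝ) := by
  have : IsFiniteMeasure (VectorMeasure.variation α) := by
    rw [← SignedMeasure.totalVariation_eq_variation]
    infer_instance
  infer_instance

theorem signedConv_apply (α β : SignedMeasure SU2) {s : Set SU2} (hs : MeasurableSet s) :
    signedConv α β s =
      VectorMeasure.prod α β (ContinuousLinearMap.mul ℝ ℝ) {p | p.1 * p.2 ∈ s} :=
  VectorMeasure.map_apply _ (measurable_fst.mul measurable_snd) hs

/-! ### Spherically symmetric random vectors and their radial laws -/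

/-- A random vector is spherically symmetric if its law is invariant under all linear isometries
of Euclidean space. -/
def IsSphericallySymmetric {Ω : Type*} [MeasurableSpace Ω] (P : Measure Ω) (X : Ω → E3) : Prop :=
  ∀ A : E3 ≃ₗᵢ[ℝ] E3, (P.map X).map A = P.map X

/-- The law of the length of a random vector. -/
noncomputable def radialLaw {Ω : Type*} [MeasurableSpace Ω] (P : Measure Ω) (X : Ω → E3) :
    Measure ℝ≥0 :=
  P.map fun ω => ‖X ω‖₊

/-- The uniform probability measure on the unit sphere of `ℝ³`. -/
noncomputable def sphereUniform : Measure (Metric.sphere (0 : E3) 1) :=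
  ((volume : Measure E3).toSphere Set.univ)⁻¹ • (volume : Measure E3).toSphere

instance instIsProbabilityMeasureSphereUniform : IsProbabilityMeasure sphereUniform := by
  refine ⟨?_⟩
  rw [sphereUniform, Measure.smul_apply, smul_eq_mul]
  refine ENNReal.inv_mul_cancel ?_ (measure_ne_top _ _)
  rw [Ne, Measure.measure_univ_eq_zero]
  exact Measure.toSphere_ne_zero _

/-- The law on `ℝ³` of a vector whose length has law `μ` and whose direction is uniformly
distributed and independent of the length. -/
noncomputable def isotropicLift (μ : Measure ℝ≥0) : Measure E3 :=
  (μ.prod sphereUniform).map fun p => (p.1 : ℝ) • (p.2 : E3)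

theorem measurable_lift :
    Measurable fun p : ℝ≥0 × Metric.sphere (0 : E3) 1 => (p.1 : ℝ) • (p.2 : E3) := by
  fun_prop

instance instIsProbabilityMeasureIsotropicLift (μ : Measure ℝ≥0) [IsProbabilityMeasure μ] : IsProbabilityMeasure (isotropicLift μ) :=
  Measure.isProbabilityMeasure_map measurable_lift.aemeasurable

/-- The convolution of radial laws: the law of the length of the sum of two independent vectors
with lengths of laws `μ` and `ν` and with independent uniformly distributed directions. -/
noncomputable def radialConv (μ ν : Measure ℝ≥0) : Measure ℝ≥0 :=
  (isotropicLift μ ∗ isotropicLift ν).map fun z => ‖z‖₊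

/-- The wrap of a radial law, identified with the spherically symmetric law on `ℝ³` it stands for:
`Φ(μ)` for a measure `μ` on the half-line. -/
noncomputable def radialWrap (ι : E3 ≃ₗ[ℝ] su2) (μ : Measure ℝ≥0) : SignedMeasure SU2 :=
  wrap ι (isotropicLift μ)

end SU2Wrapping

open SU2Wrapping

/-! The heart is a one-variable change of variables. Scale so that the angle of an element of su(2)
is its length, and take vectors `x`, `y` of lengths `r`, `s` with independent uniform directions. By
Archimedes the cosine `t` of the angle between them is uniform on [-1, 1]. The length `R` of `x + y`
satisfies R² = r² + s² + 2rst, and half the trace of exp x · exp y is c = cos r cos s - sin r sin s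
· t. Then d(cos R) = -rs (sin R / R) dt and dc = -sin r sin s dt, so the factors j(x + y) and j(x)
j(y) are exactly the Jacobians needed. For r, s > 0, the integrals over `t` of j(x + y) F(cos R) and
j(x) j(y) F(c) both equal (1/rs) times the integral of F from cos(r + s) to cos(r - s). This is
`integral_sinc_mul_comp_cos`.

Class functions on SU(2) are functions of half the trace, so this settles testing against continuous
class functions (`integral_wrap_class_function`). A general continuous test function may be replaced
by its average over conjugations: conjugation is realised on ℝ³ by isometries, which preserve both
isotropic laws (`integral_classAverage`). Continuous tests determine the signed measures
(`withDensityᵥ_map_eq_of_forall_integral_eq`).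

The radial statements rest on the fact that a rotation-invariant law is the isotropic lift of its
radial part (`isotropicLift_map_nnnorm`), proved with characteristic functions. Archimedes' theorem
itself comes from moments, found by evaluating Gaussian integrals in Cartesian and in polar
coordinates. -/

namespace SU2Wrapping

/-! ### Archimedes' theorem: coordinates of uniform points on the sphere are uniform -/

/-- Finite measures carried by a compact interval are determined by their moments. -/
theorem measure_ext_of_moments {μ ν : Measure ℝ} [IsFiniteMeasure μ] [IsFiniteMeasure ν] {a b : ℝ}
    (hμ : ∀ᵐ x ∂μ, x ∈ Set.Icc a b) (hν : ∀ᵐ x ∂ν, x ∈ Set.Icc a b)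
    (h : ∀ n : ℕ, ∫ x, x ^ n ∂μ = ∫ x, x ^ n ∂ν) : μ = ν := by
  have integrable : ∀ (ρ : Measure ℝ) [IsFiniteMeasure ρ], (∀ᵐ x ∂ρ, x ∈ Set.Icc a b) →
      ∀ f : ℝ → ℝ, Continuous f → Integrable f ρ := by
    intro ρ _ hρ f hf
    obtain ⟨C, hC⟩ := isCompact_Icc.exists_bound_of_continuousOn (s := Set.Icc a b) hf.continuousOn
    exact Integrable.of_bound hf.aestronglyMeasurable C (hρ.mono fun x hx => hC x hx)
  have poly : ∀ p : Polynomial ℝ, ∫ x, p.eval x ∂μ = ∫ x, p.eval x ∂ν := by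
    intro p
    simp_rw [Polynomial.eval_eq_sum_range]
    rw [integral_finsetSum _ fun i _ => integrable μ hμ _ (by fun_prop),
      integral_finsetSum _ fun i _ => integrable ν hν _ (by fun_prop)]
    simp_rw [integral_const_mul, h]
  refine ext_of_forall_integral_eq_of_IsFiniteMeasure fun f => ?_
  have bound : ∀ (ρ : Measure ℝ) [IsFiniteMeasure ρ], (∀ᵐ x ∂ρ, x ∈ Set.Icc a b) →
      ∀ (ε : ℝ) (p : Polynomial ℝ), (∀ x ∈ Set.Icc a b, |p.eval x - f x| < ε) →
      |∫ x, p.eval x ∂ρ - ∫ x, f x ∂ρ| ≤ ε * ρ.real Set.univ := by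
    intro ρ _ hρ ε p hp
    rw [← integral_sub (integrable ρ hρ _ p.continuous) (integrable ρ hρ _ f.continuous)]
    rw [← Real.norm_eq_abs]
    exact norm_integral_le_of_norm_le_const (hρ.mono fun x hx => (hp x hx).le)
  by_contra hne
  set d := |∫ x, f x ∂μ - ∫ x, f x ∂ν| with hd
  have hd0 : 0 < d := abs_pos.2 (sub_ne_zero.2 hne)
  set m := μ.real Set.univ + ν.real Set.univ with hm
  have hm0 : 0 ≤ m := by positivity
  -- With this tolerance the two errors add up to at most d · m / (m + 1) < d; the `+ 1` covers m =
  -- 0.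
  obtain ⟨p, hp⟩ := exists_polynomial_near_of_continuousOn a b f f.continuous.continuousOn
    (d / (m + 1)) (by positivity)
  have h1 := bound μ hμ _ p hp
  have h2 := bound ν hν _ p hp
  rw [poly p] at h1
  have h3 : d ≤ d / (m + 1) * m := by
    calc d = |(∫ x, p.eval x ∂ν - ∫ x, f x ∂ν) - (∫ x, p.eval x ∂ν - ∫ x, f x ∂μ)| := by
          rw [hd]; congr 1; ring
      _ ≤ _ := (abs_sub _ _).trans (by rw [hm, mul_add]; linarith)
  have h4 : d / (m + 1) * m < d := by
    rw [div_mul_eq_mul_div, div_lt_iff₀ (by positivity)]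
    nlinarith
  linarith

/-- Recursion for the moments of the half-line Gaussian weight. -/
theorem integral_Ioi_pow_mul_exp_neg_sq_add_two (n : ℕ) :
    ∫ t in Set.Ioi (0 : ℝ), t ^ (n + 2) * Real.exp (-t ^ 2) =
      (n + 1) / 2 * ∫ t in Set.Ioi (0 : ℝ), t ^ n * Real.exp (-t ^ 2) := by
  have key : ∀ k : ℕ, ∫ t in Set.Ioi (0 : ℝ), t ^ k * Real.exp (-t ^ 2) =
      1 / 2 * Real.Gamma ((k + 1) / 2) := by
    intro k
    have := integral_rpow_mul_exp_neg_rpow (p := 2) (q := k) (by norm_num)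
      (by have : (0 : ℝ) ≤ k := k.cast_nonneg
          linarith)
    rw [← this]
    refine setIntegral_congr_fun measurableSet_Ioi fun t _ => ?_
    simp only [Real.rpow_natCast, Real.rpow_ofNat]
  rw [key, key]
  -- Raising the exponent by two raises the Gamma argument by one, so the recursion is Γ(a + 1) = a
  -- Γ(a).
  have h : ((n + 2 : ℕ) + 1 : ℝ) / 2 = (n + 1) / 2 + 1 := by push_cast; ring
  rw [h, Real.Gamma_add_one (by positivity)]
  ring

theorem integral_Ioi_pow_mul_exp_neg_sq_pos (n : ℕ) :
    0 < ∫ t in Set.Ioi (0 : ℝ), t ^ n * Real.exp (-t ^ 2) := by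
  have := integral_rpow_mul_exp_neg_rpow (p := 2) (q := n) (by norm_num)
      (by have : (0 : ℝ) ≤ n := n.cast_nonneg
          linarith)
  simp only [Real.rpow_natCast, Real.rpow_ofNat] at this
  rw [this]
  have := Real.Gamma_pos_of_pos (s := ((n : ℝ) + 1) / 2) (by positivity)
  positivity

/-- Gaussian moments: odd ones vanish, even ones are twice those of the half-line. -/
theorem integral_pow_mul_exp_neg_sq (n : ℕ) :
    ∫ t : ℝ, t ^ n * Real.exp (-t ^ 2) =
      (1 + (-1) ^ n) * ∫ t in Set.Ioi (0 : ℝ), t ^ n * Real.exp (-t ^ 2) := by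
  rcases Nat.even_or_odd n with hn | hn
  · have := integral_comp_abs (f := fun t : ℝ => t ^ n * Real.exp (-t ^ 2))
    simp only [hn.pow_abs, sq_abs] at this
    rw [this, hn.neg_one_pow]
    ring
  · have := integral_neg_eq_self (fun t : ℝ => t ^ n * Real.exp (-t ^ 2)) volume
    simp only [hn.neg_pow, neg_sq, neg_mul, integral_neg] at this
    rw [hn.neg_one_pow]
    linarith

/-- The reflection in the hyperplane orthogonal to v - w swaps two vectors of equal length. -/
theorem exists_isometry_apply_eq {v w : E3} (h : ‖v‖ = ‖w‖) : ∃ A : E3 ≃ₗᵢ[ℝ] E3, A v = w :=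
  ⟨(ℝ ∙ (v - w))ᗮ.reflection, Submodule.reflection_sub h⟩

/-- By rotation invariance `e` may be taken to be a coordinate vector; Fubini then splits off the
two other coordinates, each contributing √π. -/
theorem integral_inner_pow_mul_gaussian {e : E3} (he : ‖e‖ = 1) (n : ℕ) :
    ∫ x : E3, inner ℝ x e ^ n * Real.exp (-‖x‖ ^ 2) =
      Real.pi * ∫ t : ℝ, t ^ n * Real.exp (-t ^ 2) := by
  obtain ⟨A, hA⟩ := exists_isometry_apply_eq (v := EuclideanSpace.single 0 1) (w := e) (by simp [he])
  rw [← A.measurePreserving.integral_comp A.toHomeomorph.measurableEmbedding]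
  simp only [LinearIsometryEquiv.norm_map, ← hA, LinearIsometryEquiv.inner_map_map]
  rw [← (PiLp.volume_preserving_toLp (Fin 3)).integral_comp
    (MeasurableEquiv.toLp 2 (Fin 3 → ℝ)).measurableEmbedding]
  have h2 : ∫ t : ℝ, Real.exp (-t ^ 2) = √Real.pi := by
    simpa using integral_gaussian 1
  have := integral_fintype_prod_volume_eq_prod
    (f := fun (i : Fin 3) (t : ℝ) => if i = 0 then t ^ n * Real.exp (-t ^ 2) else Real.exp (-t ^ 2))
  simp only [Fin.prod_univ_three, if_true, Fin.isValue, one_ne_zero, if_false, h2,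
    show (2 : Fin 3) ≠ 0 by decide] at this
  rw [mul_assoc, Real.mul_self_sqrt Real.pi_nonneg] at this
  rw [mul_comm, ← this]
  congr 1
  ext x
  simp only [EuclideanSpace.norm_sq_eq, Fin.sum_univ_three, EuclideanSpace.inner_single_right,
    Real.norm_eq_abs, sq_abs]
  simp only [neg_add, Real.exp_add]
  simp
  ring

/-- With x = t u the inner product contributes t ^ n and the polar volume density t ^ 2, whence the
exponent n + 2. -/
theorem integral_inner_pow_mul_gaussian_polar (e : E3) (n : ℕ) :
    ∫ x : E3, inner ℝ x e ^ n * Real.exp (-‖x‖ ^ 2) =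
      (∫ u, inner ℝ (u : E3) e ^ n ∂(volume : Measure E3).toSphere) *
        ∫ t in Set.Ioi (0 : ℝ), t ^ (n + 2) * Real.exp (-t ^ 2) := by
  calc ∫ x : E3, inner ℝ x e ^ n * Real.exp (-‖x‖ ^ 2)
      = ∫ x : ({(0)}ᶜ : Set E3), inner ℝ (x : E3) e ^ n * Real.exp (-‖(x : E3)‖ ^ 2)
          ∂((volume : Measure E3).comap (↑)) := by
        rw [integral_subtype_comap (measurableSet_singleton _).compl
          fun x : E3 ↦ inner ℝ x e ^ n * Real.exp (-‖x‖ ^ 2), restrict_compl_singleton]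
    _ = ∫ p, inner ℝ (p.1 : E3) e ^ n * ((p.2 : ℝ) ^ n * Real.exp (-(p.2 : ℝ) ^ 2))
          ∂(volume : Measure E3).toSphere.prod (.volumeIoiPow (Module.finrank ℝ E3 - 1)) := by
        rw [← (volume : Measure E3).measurePreserving_homeomorphUnitSphereProd.integral_comp
          (Homeomorph.measurableEmbedding _)]
        congr 1
        ext x
        have hx : ‖(x : E3)‖ ≠ 0 := norm_ne_zero_iff.2 x.2
        simp only [homeomorphUnitSphereProd_apply_fst_coe, homeomorphUnitSphereProd_apply_snd_coe,
          real_inner_smul_left, mul_pow, inv_pow]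
        field_simp
    _ = _ := by
        rw [integral_prod_mul (fun u : Metric.sphere (0 : E3) 1 => inner ℝ (u : E3) e ^ n)
          fun r : Set.Ioi (0 : ℝ) => (r : ℝ) ^ n * Real.exp (-(r : ℝ) ^ 2)]
        congr 1
        simp only [Measure.volumeIoiPow, ENNReal.ofReal]
        rw [integral_withDensity_eq_integral_smul (by fun_prop),
          integral_subtype_comap measurableSet_Ioi fun a ↦ Real.toNNReal
            (a ^ (Module.finrank ℝ E3 - 1)) • (a ^ n * Real.exp (-a ^ 2))]
        refine setIntegral_congr_fun measurableSet_Ioi fun x hx ↦ ?_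
        simp only [NNReal.smul_def, Real.coe_toNNReal _ (pow_nonneg (le_of_lt hx) _),
          finrank_euclideanSpace_fin, smul_eq_mul]
        ring

/-- The Cartesian and polar values of one Gaussian integral are equated. The moment recursion
expresses both through the same positive half-line integral, which cancels. -/
theorem integral_inner_pow_toSphere {e : E3} (he : ‖e‖ = 1) (n : ℕ) :
    ∫ u, inner ℝ (u : E3) e ^ n ∂(volume : Measure E3).toSphere =
      2 * Real.pi * (1 + (-1) ^ n) / (n + 1) := by
  have h := (integral_inner_pow_mul_gaussian_polar e n).symm.trans
    (integral_inner_pow_mul_gaussian he n)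
  rw [integral_Ioi_pow_mul_exp_neg_sq_add_two, integral_pow_mul_exp_neg_sq] at h
  have hpos := integral_Ioi_pow_mul_exp_neg_sq_pos n
  have hn : (0 : ℝ) < n + 1 := by positivity
  rw [eq_div_iff hn.ne']
  apply mul_right_cancel₀ hpos.ne'
  linarith

theorem toSphere_real_univ : (volume : Measure E3).toSphere.real Set.univ = 4 * Real.pi := by
  have h := integral_inner_pow_toSphere (e := EuclideanSpace.single 0 1) (by simp) 0
  simp only [pow_zero, integral_const, smul_eq_mul, mul_one, Nat.cast_zero, zero_add, div_one] at h
  rw [h]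
  ring

theorem integral_inner_pow_sphereUniform {e : E3} (he : ‖e‖ = 1) (n : ℕ) :
    ∫ u, inner ℝ (u : E3) e ^ n ∂sphereUniform = (1 + (-1) ^ n) / (2 * (n + 1)) := by
  rw [sphereUniform, integral_smul_measure, integral_inner_pow_toSphere he, ENNReal.toReal_inv,
    ← measureReal_def, toSphere_real_univ, smul_eq_mul]
  have := Real.pi_pos
  have hn : (0 : ℝ) < n + 1 := by positivity
  field_simp
  norm_num

theorem abs_inner_sphere_le {e : E3} (he : ‖e‖ = 1) (u : Metric.sphere (0 : E3) 1) :
    |inner ℝ (u : E3) e| ≤ 1 := by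
  simpa [he] using abs_real_inner_le_norm (u : E3) e

/-- **Archimedes' theorem** in three-space: the component of a uniform point of the unit sphere in
a fixed direction is uniform on `[-1, 1]`. -/
theorem sphereUniform_map_inner {e : E3} (he : ‖e‖ = 1) :
    sphereUniform.map (fun u : Metric.sphere (0 : E3) 1 => inner ℝ (u : E3) e) =
      (2 : ℝ≥0)⁻¹ • volume.restrict (Set.Icc (-1 : ℝ) 1) := by
  have hm : Measurable fun u : Metric.sphere (0 : E3) 1 => inner ℝ (u : E3) e := by fun_prop
  refine measure_ext_of_moments (a := -1) (b := 1) ?_ ?_ fun n => ?_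
  · refine (ae_map_iff hm.aemeasurable (p := fun x => x ∈ Set.Icc (-1) 1) measurableSet_Icc).2 ?_
    exact Filter.Eventually.of_forall fun u => abs_le.1 (abs_inner_sphere_le he u)
  · exact Measure.ae_smul_measure (ae_restrict_mem measurableSet_Icc) _
  · rw [integral_map hm.aemeasurable (by fun_prop), integral_inner_pow_sphereUniform he,
      integral_smul_nnreal_measure, integral_Icc_eq_integral_Ioc,
      ← intervalIntegral.integral_of_le (by norm_num), integral_pow, NNReal.smul_def]
    have hn : (n + 1 : ℝ) ≠ 0 := by positivity
    simp only [NNReal.coe_inv, NNReal.coe_ofNat, smul_eq_mul, one_pow, pow_succ]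
    field_simp
    ring

theorem integral_sphereUniform_inner {F : Type*} [NormedAddCommGroup F] [NormedSpace ℝ F]
    {e : E3} (he : ‖e‖ = 1) {φ : ℝ → F}
    (hφ : Continuous φ) :
    ∫ u, φ (inner ℝ (u : E3) e) ∂sphereUniform = (2 : ℝ)⁻¹ • ∫ t in (-1 : ℝ)..1, φ t := by
  have hm : Measurable fun u : Metric.sphere (0 : E3) 1 => inner ℝ (u : E3) e := by fun_prop
  rw [← integral_map hm.aemeasurable (f := φ) hφ.aestronglyMeasurable, sphereUniform_map_inner he,
    integral_smul_nnreal_measure, integral_Icc_eq_integral_Ioc,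
    ← intervalIntegral.integral_of_le (by norm_num)]
  rfl

/-! ### Rotation-invariant laws are determined by their radial parts -/

/-- The spherical function of `ℝ³` with frequency `t`. -/
noncomputable def sphericalFun (t : ℝ) : ℂ :=
  (2 : ℝ)⁻¹ • ∫ s in (-1 : ℝ)..1, Complex.exp ((t * s : ℝ) * Complex.I)

theorem integral_sphereUniform_cexp (x : E3) :
    ∫ u, Complex.exp ((inner ℝ (u : E3) x : ℝ) * Complex.I) ∂sphereUniform =
      sphericalFun ‖x‖ := by
  rcases eq_or_ne x 0 with rfl | hx
  · simp [sphericalFun]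
    norm_num
  · have he : ‖(‖x‖⁻¹ • x : E3)‖ = 1 := by
      rw [norm_smul, norm_inv, norm_norm, inv_mul_cancel₀ (norm_ne_zero_iff.2 hx)]
    rw [sphericalFun, ← integral_sphereUniform_inner he
      (φ := fun s => Complex.exp ((‖x‖ * s : ℝ) * Complex.I)) (by fun_prop)]
    congr 1
    ext u
    rw [real_inner_smul_right, mul_inv_cancel_left₀ (norm_ne_zero_iff.2 hx)]

theorem charFun_isotropicLift (μ : Measure ℝ≥0) [IsProbabilityMeasure μ] (ξ : E3) :
    charFun (isotropicLift μ) ξ = ∫ r, sphericalFun (r * ‖ξ‖) ∂μ := by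
  rw [charFun_apply, isotropicLift, integral_map measurable_lift.aemeasurable (by fun_prop),
    integral_prod]
  · congr 1
    ext r
    have := integral_sphereUniform_cexp ((r : ℝ) • ξ)
    simp only [real_inner_smul_right, norm_smul, Real.norm_eq_abs, NNReal.abs_eq] at this
    simpa only [real_inner_smul_left] using this
  · refine Integrable.of_bound (C := 1) (by fun_prop) (Filter.Eventually.of_forall fun p => ?_)
    exact (Complex.norm_exp_ofReal_mul_I _).le

theorem charFun_eq_of_invariant {ν : Measure E3} (hν : ∀ A : E3 ≃ₗᵢ[ℝ] E3, ν.map A = ν) {ξ η : E3}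
    (h : ‖ξ‖ = ‖η‖) : charFun ν ξ = charFun ν η := by
  obtain ⟨A, hA⟩ := exists_isometry_apply_eq h
  conv_rhs => rw [← hν A]
  rw [charFun_apply, charFun_apply, integral_map (by fun_prop) (by fun_prop)]
  simp only [← hA, LinearIsometryEquiv.inner_map_map]

/-- The characteristic function is constant on the sphere of radius ‖ξ‖, so it equals its average
there. Fubini turns this into an average over frequency directions, which is symmetric in ‖x‖ and
‖ξ‖ and so matches `charFun_isotropicLift`. -/
theorem charFun_of_invariant {ν : Measure E3} [IsProbabilityMeasure ν]
    (hν : ∀ A : E3 ≃ₗᵢ[ℝ] E3, ν.map A = ν) (ξ : E3) :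
    charFun ν ξ = ∫ x, sphericalFun (‖x‖ * ‖ξ‖) ∂ν := by
  calc charFun ν ξ = ∫ u, charFun ν (‖ξ‖ • (u : E3)) ∂sphereUniform := by
        rw [integral_congr_ae (g := fun _ => charFun ν ξ), integral_const, probReal_univ, one_smul]
        refine Filter.Eventually.of_forall fun u => charFun_eq_of_invariant hν ?_
        simp [norm_smul]
    _ = ∫ x, ∫ u, Complex.exp ((inner ℝ x (‖ξ‖ • (u : E3)) : ℝ) * Complex.I) ∂sphereUniform ∂ν := by
        simp only [charFun_apply]
        rw [integral_integral_swap]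
        refine Integrable.of_bound (C := 1) (Continuous.aestronglyMeasurable (by fun_prop))
          (Filter.Eventually.of_forall fun p => ?_)
        exact (Complex.norm_exp_ofReal_mul_I _).le
    _ = _ := by
        congr 1
        ext x
        have := integral_sphereUniform_cexp (‖ξ‖ • x)
        simp only [real_inner_smul_right, norm_smul, norm_norm] at this
        simp only [real_inner_comm _ x, real_inner_smul_left]
        rw [this, mul_comm]

theorem continuous_sphericalFun : Continuous sphericalFun := by
  have : Continuous fun t : ℝ => ∫ s in (-1 : ℝ)..1, Complex.exp ((t * s : ℝ) * Complex.I) :=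
    intervalIntegral.continuous_parametric_intervalIntegral_of_continuous'
      (f := fun t s : ℝ => Complex.exp ((t * s : ℝ) * Complex.I)) (by fun_prop) _ _
  exact this.const_smul (2 : ℝ)⁻¹

/-- A rotation-invariant law on `ℝ³` is the isotropic lift of its radial part. -/
theorem isotropicLift_map_nnnorm {ν : Measure E3} [IsProbabilityMeasure ν]
    (hν : ∀ A : E3 ≃ₗᵢ[ℝ] E3, ν.map A = ν) : isotropicLift (ν.map fun x => ‖x‖₊) = ν := by
  have : IsProbabilityMeasure (ν.map fun x => ‖x‖₊) := Measure.isProbabilityMeasure_map (by fun_prop)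
  refine Measure.ext_of_charFun (funext fun ξ => ?_)
  rw [charFun_isotropicLift, charFun_of_invariant hν, integral_map (by fun_prop)]
  · rfl
  · exact (continuous_sphericalFun.comp (by fun_prop)).aestronglyMeasurable

/-- The characteristic function of an isotropic lift sees `ξ` only through ‖ξ‖. -/
theorem isotropicLift_map (μ : Measure ℝ≥0) [IsProbabilityMeasure μ] (A : E3 ≃ₗᵢ[ℝ] E3) :
    (isotropicLift μ).map A = isotropicLift μ := by
  have : IsProbabilityMeasure ((isotropicLift μ).map A) :=
    Measure.isProbabilityMeasure_map (by fun_prop)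
  refine Measure.ext_of_charFun (funext fun ξ => ?_)
  have h : charFun ((isotropicLift μ).map A) ξ = charFun (isotropicLift μ) (A.symm ξ) := by
    rw [charFun_apply, charFun_apply, integral_map (by fun_prop) (by fun_prop)]
    congr 1
    ext x
    rw [← A.inner_map_map x, A.apply_symm_apply]
  rw [h, charFun_isotropicLift, charFun_isotropicLift, LinearIsometryEquiv.norm_map]

theorem conv_map_isometry {ν₁ ν₂ : Measure E3} [IsProbabilityMeasure ν₁] [IsProbabilityMeasure ν₂]
    {A : E3 ≃ₗᵢ[ℝ] E3} (h₁ : ν₁.map A = ν₁) (h₂ : ν₂.map A = ν₂) :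
    (ν₁ ∗ ν₂).map A = ν₁ ∗ ν₂ := by
  have hA : Measurable A := by fun_prop
  conv_rhs => rw [← h₁, ← h₂]
  rw [Measure.conv, Measure.conv, Measure.map_prod_map _ _ hA hA, Measure.map_map hA (by fun_prop),
    Measure.map_map (by fun_prop) (by fun_prop)]
  congr 1
  ext1 p
  simp

/-- The convolution of two isotropic laws is isotropic, with radial law their radial convolution. -/
theorem isotropicLift_radialConv (μ ν : Measure ℝ≥0) [IsProbabilityMeasure μ]
    [IsProbabilityMeasure ν] :
    isotropicLift (radialConv μ ν) = isotropicLift μ ∗ isotropicLift ν :=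
  isotropicLift_map_nnnorm fun A => conv_map_isometry (isotropicLift_map μ A) (isotropicLift_map ν A)

/-! ### SU(2) as a compact topological group -/

instance instIsTopologicalGroupSU2 : IsTopologicalGroup SU2 where
  continuous_mul := continuous_mul
  continuous_inv := by
    refine Continuous.subtype_mk (f := fun g : SU2 => star (g : Matrix (Fin 2) (Fin 2) ℂ)) ?_ _
    exact continuous_star.comp continuous_subtype_val

instance instCompactSpaceSU2 : CompactSpace SU2 := by
  refine isCompact_iff_compactSpace.1 ?_
  -- Entries of a unitary matrix have modulus at most one, so SU(2) is a closed subset of a product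
  -- of discs.
  have hK : IsCompact (Set.univ.pi fun _ => Set.univ.pi fun _ => Metric.closedBall 0 1 :
      Set (Fin 2 → Fin 2 → ℂ)) :=
    isCompact_univ_pi fun _ => isCompact_univ_pi fun _ => isCompact_closedBall 0 1
  refine IsCompact.of_isClosed_subset (X := Matrix (Fin 2) (Fin 2) ℂ) hK ?_ fun U hU => ?_
  · have : (Matrix.specialUnitaryGroup (Fin 2) ℂ : Set (Matrix (Fin 2) (Fin 2) ℂ)) =
        {U | U * star U = 1} ∩ {U | U.det = 1} := by
      ext U
      rw [SetLike.mem_coe, Matrix.mem_specialUnitaryGroup_iff, Matrix.mem_unitaryGroup_iff]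
      rfl
    rw [this]
    exact (isClosed_eq (continuous_id.mul continuous_star) continuous_const).inter
      (isClosed_eq continuous_id.matrix_det continuous_const)
  · exact fun i _ j _ => mem_closedBall_zero_iff.2
      (entry_norm_bound_of_unitary (Matrix.mem_specialUnitaryGroup_iff.1 hU).1 i j)

theorem SU2.coe_inv (g : SU2) :
    ((g⁻¹ : SU2) : Matrix (Fin 2) (Fin 2) ℂ) = star (g : Matrix (Fin 2) (Fin 2) ℂ) := rfl

theorem SU2.star_mul_coe (g : SU2) :
    star (g : Matrix (Fin 2) (Fin 2) ℂ) * (g : Matrix (Fin 2) (Fin 2) ℂ) = 1 :=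
  Matrix.mem_unitaryGroup_iff'.1 (Matrix.mem_specialUnitaryGroup_iff.1 g.2).1

theorem SU2.coe_mul_star (g : SU2) :
    (g : Matrix (Fin 2) (Fin 2) ℂ) * star (g : Matrix (Fin 2) (Fin 2) ℂ) = 1 :=
  Matrix.mem_unitaryGroup_iff.1 (Matrix.mem_specialUnitaryGroup_iff.1 g.2).1

theorem SU2.nonsing_inv (g : SU2) :
    (g : Matrix (Fin 2) (Fin 2) ℂ)⁻¹ = star (g : Matrix (Fin 2) (Fin 2) ℂ) :=
  Matrix.inv_eq_left_inv g.star_mul_coe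

theorem SU2.star_eq_adjugate (g : SU2) :
    star (g : Matrix (Fin 2) (Fin 2) ℂ) = (g : Matrix (Fin 2) (Fin 2) ℂ).adjugate := by
  rw [← g.nonsing_inv, Matrix.inv_def, (Matrix.mem_specialUnitaryGroup_iff.1 g.2).2]
  simp

theorem SU2.apply_one_one (g : SU2) : g.1 1 1 = star (g.1 0 0) := by
  simpa [Matrix.adjugate_fin_two] using (congrFun (congrFun g.star_eq_adjugate 0) 0).symm

theorem SU2.apply_one_zero (g : SU2) : g.1 1 0 = -star (g.1 0 1) := by
  have := congrFun (congrFun g.star_eq_adjugate 1) 0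
  simp [Matrix.adjugate_fin_two] at this
  simp [this]

/-- A nonzero real quaternion, written as a complex matrix, can be normalized to lie in SU(2). -/
theorem exists_SU2_eq_smul (a b : ℂ) (h : 0 < Complex.normSq a + Complex.normSq b) :
    ∃ (g : SU2) (c : ℂ), c ≠ 0 ∧
      (g : Matrix (Fin 2) (Fin 2) ℂ) = c • !![a, b; -star b, star a] := by
  set n := Complex.normSq a + Complex.normSq b with hn
  set c : ℂ := (((√n)⁻¹ : ℝ) : ℂ) with hc
  have hc2 : c * c * (a * star a + b * star b) = 1 := by
    have h1 : a * star a + b * star b = (n : ℝ) := by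
      simp [hn, Complex.mul_conj]
    rw [h1, hc, ← Complex.ofReal_mul, ← Complex.ofReal_mul, ← mul_inv, Real.mul_self_sqrt h.le,
      inv_mul_cancel₀ h.ne', Complex.ofReal_one]
  have hcs : star c = c := Complex.conj_ofReal _
  refine ⟨⟨c • !![a, b; -star b, star a], ?_⟩, c, ?_, rfl⟩
  · rw [Matrix.mem_specialUnitaryGroup_iff, Matrix.mem_unitaryGroup_iff]
    refine ⟨?_, ?_⟩
    · have hst : star !![a, b; -star b, star a] = !![star a, -b; star b, a] := by
        ext i j
        fin_cases i <;> fin_cases j <;> simp [Matrix.star_apply]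
      rw [star_smul, hcs, smul_mul_smul_comm, hst]
      ext i j
      fin_cases i <;> fin_cases j <;>
        simp <;>
        first
        | (right; ring1)
        | (simp only [Complex.star_def] at hc2; linear_combination hc2)
    · rw [Matrix.det_smul, Matrix.det_fin_two]
      simp only [Fintype.card_fin, Matrix.of_apply, Matrix.cons_val', Matrix.cons_val_zero,
        Matrix.cons_val_one, Matrix.cons_val_fin_one]
      linear_combination hc2
  · rw [hc, Complex.ofReal_ne_zero]
    exact inv_ne_zero (Real.sqrt_pos.2 h).ne'

/-! ### Adjoint orbits -/

theorem su2.apply_one_one (X : su2) : X.1 1 1 = -X.1 0 0 := by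
  have := X.2.2
  rw [Matrix.trace_fin_two] at this
  exact eq_neg_of_add_eq_zero_right this

theorem su2.apply_one_zero (X : su2) : X.1 1 0 = -star (X.1 0 1) := by
  have := congrFun (congrFun X.2.1 0) 1
  simp [Matrix.star_apply] at this
  rw [← neg_eq_iff_eq_neg] at this
  rw [← this]
  simp

theorem su2.apply_zero_zero (X : su2) : X.1 0 0 = (X.1 0 0).im * Complex.I := by
  have := congrArg Complex.re (congrFun (congrFun X.2.1 0) 0)
  simp [Matrix.star_apply] at this
  apply Complex.ext <;> simp
  linarith

theorem su2.det_eq (X : su2) :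
    X.1.det = ((X.1 0 0).im ^ 2 + Complex.normSq (X.1 0 1) : ℝ) := by
  rw [Matrix.det_fin_two, su2.apply_one_one X, su2.apply_one_zero X]
  simp only [Complex.ofReal_add, Complex.ofReal_pow, ← Complex.mul_conj, Complex.star_def]
  linear_combination (-(X.1 0 0) - (X.1 0 0).im * Complex.I) * su2.apply_zero_zero X -
    ((X.1 0 0).im : ℂ) ^ 2 * Complex.I_sq

/-- The nonnegative number `θ` such that `X` has eigenvalues `± i θ`. -/
noncomputable def angle (X : su2) : ℝ := √(X.1.det.re)

theorem angle_nonneg (X : su2) : 0 ≤ angle X := Real.sqrt_nonneg _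

theorem det_eq_angle_sq (X : su2) : X.1.det = (angle X ^ 2 : ℝ) := by
  rw [angle, su2.det_eq X, Complex.ofReal_re, Real.sq_sqrt]
  have := Complex.normSq_nonneg (X.1 0 1)
  positivity

theorem jFun_eq_sinc_angle (X : su2) : jFun X = Real.sinc (angle X) := by
  rw [jFun, posRoot, mul_div_cancel_left₀ _ two_ne_zero, angle]

/-- Cayley–Hamilton for trace zero. -/
theorem mul_self_eq (X : su2) : X.1 * X.1 = -((angle X ^ 2 : ℝ) : ℂ) • 1 := by
  rw [← det_eq_angle_sq, Matrix.det_fin_two]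
  ext i j
  fin_cases i <;> fin_cases j <;> simp [Matrix.mul_apply, Fin.sum_univ_two, su2.apply_one_one X] <;> ring

theorem Ad_mul (g h : SU2) (X : su2) : Ad (g * h) X = Ad g (Ad h X) := by
  apply Subtype.ext
  change (g.1 * h.1) * X.1 * star (g.1 * h.1) = g.1 * (h.1 * X.1 * star h.1) * star g.1
  rw [star_mul]
  simp only [mul_assoc]

theorem Ad_inv_Ad (g : SU2) (X : su2) : Ad g⁻¹ (Ad g X) = X := by
  rw [← Ad_mul, inv_mul_cancel]
  apply Subtype.ext
  change (1 : Matrix (Fin 2) (Fin 2) ℂ) * X.1 * star 1 = X.1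
  simp

theorem Ad_eq_of_mul_eq {g : SU2} {X Y : su2} (h : g.1 * X.1 = Y.1 * g.1) : Ad g X = Y := by
  apply Subtype.ext
  change g.1 * X.1 * star g.1 = Y.1
  rw [h, mul_assoc, g.coe_mul_star, mul_one]

theorem det_Ad (g : SU2) (X : su2) : (Ad g X).1.det = X.1.det := by
  change (g.1 * X.1 * star g.1).det = X.1.det
  rw [Matrix.det_mul_comm, ← mul_assoc, g.star_mul_coe, one_mul]

theorem angle_Ad (g : SU2) (X : su2) : angle (Ad g X) = angle X := by
  rw [angle, angle, det_Ad]

/-- The generator of the standard maximal torus. -/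
noncomputable def torusGen : su2 := ⟨!![Complex.I, 0; 0, -Complex.I], by
  refine ⟨?_, ?_⟩
  · ext i j
    fin_cases i <;> fin_cases j <;> simp [Matrix.star_apply]
  · simp [Matrix.trace_fin_two]⟩

/-- Every element of the Lie algebra is conjugate to an element of the standard torus. -/
theorem exists_Ad_eq_smul_torusGen (X : su2) : ∃ g : SU2, Ad g X = angle X • torusGen := by
  set x := (X.1 0 0).im with hx
  set b := X.1 0 1 with hb
  set s := angle X with hs
  have hX : X.1 = !![x * Complex.I, b; -star b, -(x * Complex.I)] := by
    ext i j
    fin_cases i <;> fin_cases j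
    · exact (su2.apply_zero_zero X)
    · rfl
    · exact (su2.apply_one_zero X)
    · change X.1 1 1 = _
      rw [su2.apply_one_one X, su2.apply_zero_zero X]
      rfl
  have hs2 : s ^ 2 = x ^ 2 + Complex.normSq b := by
    have := (det_eq_angle_sq X).symm.trans (su2.det_eq X)
    exact_mod_cast this
  have hT : (s • torusGen).1 = !![s * Complex.I, 0; 0, -(s * Complex.I)] := by
    change s • (!![Complex.I, 0; 0, -Complex.I] : Matrix (Fin 2) (Fin 2) ℂ) = _
    ext i j
    fin_cases i <;> fin_cases j <;> simp
  have conj : ∀ a c : ℂ, 0 < Complex.normSq a + Complex.normSq c →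
      !![a, c; -star c, star a] * X.1 = (s • torusGen).1 * !![a, c; -star c, star a] →
      ∃ g : SU2, Ad g X = s • torusGen := by
    intro a c hac h
    obtain ⟨g, k, -, hg⟩ := exists_SU2_eq_smul a c hac
    refine ⟨g, Ad_eq_of_mul_eq ?_⟩
    rw [hg, smul_mul_assoc, h, mul_smul_comm]
  by_cases h : 0 < (s + x) ^ 2 + Complex.normSq b
  -- The intertwiner is s - T X with T = `torusGen`: since X² = -s² and T² = -1, both (s - T X) X
  -- and s T (s - T X) equal s X + s² T.
  · refine conj ((s + x : ℝ)) (-Complex.I * b) ?_ ?_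
    · rw [Complex.normSq_ofReal, ← sq]
      simpa using h
    · have h3 : (s : ℂ) ^ 2 = x ^ 2 + b * star b := by
        rw [Complex.star_def, Complex.mul_conj]
        exact_mod_cast hs2
      rw [hX, hT]
      ext i j
      fin_cases i <;> fin_cases j <;> simp [Matrix.mul_apply, Fin.sum_univ_two] <;>
        simp only [Complex.star_def] at h3 <;>
        first
        | linear_combination -Complex.I * h3
        | linear_combination Complex.I * h3
        | ring1
        | linear_combination (b * x + b * s) * Complex.I_sq
        | linear_combination (-(starRingEnd ℂ b * x) - starRingEnd ℂ b * s) * Complex.I_sq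
  · have hb0 : Complex.normSq b = 0 := by
      nlinarith [Complex.normSq_nonneg b, sq_nonneg (s + x)]
    have hsx : (s : ℂ) = -x := by
      have : (s + x) ^ 2 = 0 := by nlinarith [sq_nonneg (s + x)]
      have := eq_neg_of_add_eq_zero_left (pow_eq_zero_iff two_ne_zero |>.1 this)
      exact_mod_cast this
    -- Here X = -s T, and the Weyl group element exchanges the two eigenlines.
    refine conj 0 1 (by simp) ?_
    rw [hX, hT, Complex.normSq_eq_zero.1 hb0, hsx]
    ext i j
    fin_cases i <;> fin_cases j <;> simp [Matrix.mul_apply, Fin.sum_univ_two]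

/-- Two elements of the Lie algebra with the same eigenvalues are conjugate. -/
theorem exists_Ad_eq {X Y : su2} (h : angle X = angle Y) : ∃ g : SU2, Ad g X = Y := by
  obtain ⟨g, hg⟩ := exists_Ad_eq_smul_torusGen X
  obtain ⟨k, hk⟩ := exists_Ad_eq_smul_torusGen Y
  refine ⟨k⁻¹ * g, ?_⟩
  rw [Ad_mul, hg, h, ← hk, Ad_inv_Ad]

/-! ### The exponential map -/

theorem expSU2_Ad (g : SU2) (X : su2) : expSU2 (Ad g X) = g * expSU2 X * g⁻¹ := by
  apply Subtype.ext
  have hu : IsUnit g.1 := .of_mul_eq_one _ g.coe_mul_star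
  have := Matrix.exp_conj g.1 X.1 hu
  rw [g.nonsing_inv] at this
  exact this

theorem expSU2_smul_torusGen (t : ℝ) :
    (expSU2 (t • torusGen)).1 = (Real.cos t : ℂ) • 1 + (Real.sin t : ℂ) • torusGen.1 := by
  have h : (t • torusGen).1 = Matrix.diagonal ![t * Complex.I, -(t * Complex.I)] := by
    change t • (!![Complex.I, 0; 0, -Complex.I] : Matrix (Fin 2) (Fin 2) ℂ) = _
    ext i j
    fin_cases i <;> fin_cases j <;> simp
  change NormedSpace.exp (t • torusGen).1 = _
  rw [h, Matrix.exp_diagonal]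
  change _ = (Real.cos t : ℂ) • 1 + (Real.sin t : ℂ) • !![Complex.I, 0; 0, -Complex.I]
  ext i j
  fin_cases i <;> fin_cases j <;>
    simp [Pi.coe_exp, ← Complex.exp_eq_exp_ℂ, Complex.exp_mul_I, ← neg_mul]

/-- Euler's formula for the exponential map of SU(2). -/
theorem coe_expSU2 (X : su2) :
    (expSU2 X).1 = (Real.cos (angle X) : ℂ) • 1 + (Real.sinc (angle X) : ℂ) • X.1 := by
  obtain ⟨g, hg⟩ := exists_Ad_eq_smul_torusGen X
  have h1 : expSU2 X = g⁻¹ * expSU2 (angle X • torusGen) * g := by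
    rw [← hg, expSU2_Ad]
    group
  have h2 : star g.1 * (angle X • torusGen).1 * g.1 = X.1 := by
    rw [← hg]
    change star g.1 * (g.1 * X.1 * star g.1) * g.1 = X.1
    simp only [mul_assoc, g.star_mul_coe, mul_one]
    rw [← mul_assoc, g.star_mul_coe, one_mul]
  have h3 : (Real.sin (angle X) : ℂ) • torusGen.1 =
      (Real.sinc (angle X) : ℂ) • (angle X • torusGen).1 := by
    change _ = (Real.sinc (angle X) : ℂ) • (angle X • torusGen.1)
    rw [← Complex.coe_smul (angle X), smul_smul, ← Complex.ofReal_mul]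
    congr 2
    by_cases h : angle X = 0
    · simp [h]
    · rw [Real.sinc_of_ne_zero h, div_mul_cancel₀ _ h]
  rw [h1]
  change star g.1 * (expSU2 (angle X • torusGen)).1 * g.1 = _
  rw [expSU2_smul_torusGen, h3, mul_add, add_mul, mul_smul_comm, mul_smul_comm, smul_mul_assoc,
    smul_mul_assoc, mul_one, g.star_mul_coe, h2]

theorem trace_expSU2 (X : su2) : (expSU2 X).1.trace = (2 * Real.cos (angle X) : ℝ) := by
  rw [coe_expSU2, Matrix.trace_add, Matrix.trace_smul, Matrix.trace_smul, X.2.2]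
  simp [mul_comm]

/-- The spherical law of cosines: in the product of two Euler formulas the mixed terms are
traceless. -/
theorem trace_expSU2_mul_expSU2 (X Y : su2) :
    (expSU2 X * expSU2 Y).1.trace =
      (2 * (Real.cos (angle X) * Real.cos (angle Y)) : ℝ) +
        (Real.sinc (angle X) * Real.sinc (angle Y) : ℝ) * (X.1 * Y.1).trace := by
  change ((expSU2 X).1 * (expSU2 Y).1).trace = _
  rw [coe_expSU2, coe_expSU2]
  simp only [add_mul, mul_add, Matrix.trace_add, smul_mul_smul_comm, Matrix.trace_smul, mul_one,
    one_mul, X.2.2, Y.2.2, Matrix.trace_one]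
  simp
  ring

/-- Elements of SU(2) with the same trace are conjugate. -/
theorem exists_conj_eq_of_trace_eq {g h : SU2} (hgh : g.1.trace = h.1.trace) :
    ∃ k : SU2, k * g * k⁻¹ = h := by
  -- The traceless part of `g` lies in su(2), and its determinant, hence its angle, depends only on
  -- the trace; conjugacy then reduces to `exists_Ad_eq`.
  have decomp : ∀ g : SU2, ∃ Y : su2, g.1 = (g.1.trace / 2) • 1 + Y.1 ∧
      Y.1.det = 1 - (g.1.trace / 2) ^ 2 := by
    intro g
    have hdet := (Matrix.mem_specialUnitaryGroup_iff.1 g.2).2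
    rw [Matrix.det_fin_two] at hdet
    refine ⟨⟨g.1 - (g.1.trace / 2) • 1, ?_, ?_⟩, by simp, ?_⟩
    · rw [Matrix.trace_fin_two]
      ext i j
      fin_cases i <;> fin_cases j <;>
        simp [Matrix.star_apply, g.apply_one_one, g.apply_one_zero] <;> ring
    · simp only [Matrix.trace_sub, Matrix.trace_smul, Matrix.trace_one]
      simp
    · change (g.1 - (g.1.trace / 2) • 1).det = _
      rw [Matrix.trace_fin_two, Matrix.det_fin_two]
      simp
      linear_combination hdet
  obtain ⟨Y, hY, hYd⟩ := decomp g
  obtain ⟨Z, hZ, hZd⟩ := decomp h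
  have hang : angle Y = angle Z := by
    rw [angle, angle, hYd, hZd, hgh]
  obtain ⟨k, hk⟩ := exists_Ad_eq hang
  refine ⟨k, Subtype.ext ?_⟩
  change k.1 * g.1 * star k.1 = h.1
  have hk' : k.1 * Y.1 * star k.1 = Z.1 := congrArg Subtype.val hk
  rw [hY, mul_add, add_mul, hk', hZ, hgh, mul_smul_comm, smul_mul_assoc, mul_one, k.coe_mul_star]

/-- A class function on SU(2) is a function of the trace. -/
theorem class_function_eq_of_trace_eq {α : Type*} {f : SU2 → α}
    (hf : ∀ k g : SU2, f (k * g * k⁻¹) = f g)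
    {g h : SU2} (hgh : g.1.trace = h.1.trace) : f g = f h := by
  obtain ⟨k, rfl⟩ := exists_conj_eq_of_trace_eq hgh
  rw [hf]

/-! ### Ad-invariant identifications -/

theorem torusGen_ne_zero : torusGen ≠ 0 := by
  intro h
  have := congrFun (congrFun (congrArg Subtype.val h) 0) 0
  simp [torusGen] at this

/-- An Ad-invariant norm on the Lie algebra is a multiple of the standard one. -/
theorem IsAdInvariant.exists_angle_eq {ι : E3 ≃ₗ[ℝ] su2} (hι : IsAdInvariant ι) :
    ∃ κ : ℝ, 0 < κ ∧ ∀ x, angle (ι x) = κ * ‖x‖ := by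
  have hm : 0 < ‖ι.symm torusGen‖ :=
    norm_pos_iff.2 (ι.symm.map_eq_zero_iff.not.2 torusGen_ne_zero)
  refine ⟨‖ι.symm torusGen‖⁻¹, inv_pos.2 hm, fun x => ?_⟩
  -- Moving ι x along its orbit to the torus gives ‖x‖ = angle (ι x) · ‖ι⁻¹ T‖, which dictates κ.
  obtain ⟨g, hg⟩ := exists_Ad_eq_smul_torusGen (ι x)
  have := hι g x
  rw [hg, map_smul, norm_smul, Real.norm_eq_abs, abs_of_nonneg (angle_nonneg _)] at this
  rw [← this]
  field_simp

/-- Polarization of the case x = y, which is `mul_self_eq`. -/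
theorem trace_mul_eq_inner {ι : E3 ≃ₗ[ℝ] su2} {κ : ℝ} (hκ : ∀ x, angle (ι x) = κ * ‖x‖) (x y : E3) :
    ((ι x).1 * (ι y).1).trace = (-2 * κ ^ 2 * inner ℝ x y : ℝ) := by
  have hsq : ∀ z, ((ι z).1 * (ι z).1).trace = (-2 * κ ^ 2 * ‖z‖ ^ 2 : ℝ) := by
    intro z
    rw [mul_self_eq, hκ, Matrix.trace_smul, Matrix.trace_one]
    simp
    ring
  have h := hsq (x + y)
  rw [map_add, Submodule.coe_add, add_mul, mul_add, mul_add, Matrix.trace_add, Matrix.trace_add,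
    Matrix.trace_add, hsq, hsq, Matrix.trace_mul_comm (ι y).1, norm_add_sq_real] at h
  have h2 : 2 * ((ι x).1 * (ι y).1).trace = 2 * (-2 * κ ^ 2 * inner ℝ x y : ℝ) := by
    push_cast at h ⊢
    linear_combination h
  exact mul_left_cancel₀ two_ne_zero h2

/-- The adjoint action, transported to an isometry of `ℝ³`. -/
theorem IsAdInvariant.exists_isometry {ι : E3 ≃ₗ[ℝ] su2} (hι : IsAdInvariant ι) (g : SU2) :
    ∃ A : E3 ≃ₗᵢ[ℝ] E3, ∀ x, ι (A x) = Ad g (ι x) := by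
  let L : E3 →ₗᵢ[ℝ] E3 :=
    { toFun := fun x => ι.symm (Ad g (ι x))
      map_add' := fun x y => by
        rw [← map_add]
        congr 1
        apply Subtype.ext
        simp [Ad, mul_add, add_mul]
      map_smul' := fun c x => by
        rw [RingHom.id_apply, ← map_smul]
        congr 1
        apply Subtype.ext
        simp [Ad]
      norm_map' := fun x => hι g x }
  refine ⟨L.toLinearIsometryEquiv rfl, fun x => ?_⟩
  change ι (ι.symm (Ad g (ι x))) = _
  rw [LinearEquiv.apply_symm_apply]

/-! ### Integration against isotropic laws -/

theorem integral_isotropicLift (μ : Measure ℝ≥0) [IsProbabilityMeasure μ] {h : E3 → ℝ}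
    (hm : StronglyMeasurable h) {C : ℝ} (hC : ∀ x, ‖h x‖ ≤ C) :
    ∫ x, h x ∂isotropicLift μ = ∫ r, ∫ u, h ((r : ℝ) • (u : E3)) ∂sphereUniform ∂μ := by
  rw [isotropicLift, integral_map measurable_lift.aemeasurable hm.aestronglyMeasurable, integral_prod]
  exact Integrable.of_bound (hm.comp_measurable measurable_lift).aestronglyMeasurable C
    (Filter.Eventually.of_forall fun p => hC _)

/-- Integration of a function of two lengths and an inner product against two independent isotropic
vectors. -/
theorem integral_isotropicLift_prod (μ ν : Measure ℝ≥0) [IsProbabilityMeasure μ]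
    [IsProbabilityMeasure ν] {K : ℝ → ℝ → ℝ → ℝ}
    (hK : Continuous fun p : ℝ × ℝ × ℝ => K p.1 p.2.1 p.2.2) {C : ℝ} (hC : ∀ a b c, ‖K a b c‖ ≤ C) :
    ∫ p, K ‖p.1‖ ‖p.2‖ (inner ℝ p.1 p.2) ∂(isotropicLift μ).prod (isotropicLift ν) =
      ∫ r : ℝ≥0, ∫ s : ℝ≥0, (2 : ℝ)⁻¹ • (∫ t in (-1 : ℝ)..1, K r s (r * s * t)) ∂ν ∂μ := by
  have hcont : Continuous fun p : E3 × E3 => K ‖p.1‖ ‖p.2‖ (inner ℝ p.1 p.2) :=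
    hK.comp (by fun_prop : Continuous fun p : E3 × E3 => (‖p.1‖, ‖p.2‖, inner ℝ p.1 p.2))
  have inner_integral : ∀ x : E3, ∫ y, K ‖x‖ ‖y‖ (inner ℝ x y) ∂isotropicLift ν =
      ∫ s : ℝ≥0, (2 : ℝ)⁻¹ • (∫ t in (-1 : ℝ)..1, K ‖x‖ s (‖x‖ * s * t)) ∂ν := by
    intro x
    rw [integral_isotropicLift ν (h := fun y => K ‖x‖ ‖y‖ (inner ℝ x y))
      (hcont.comp (by fun_prop : Continuous fun y : E3 => (x, y))).stronglyMeasurable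
      (fun y => hC _ _ _)]
    congr 1
    ext s
    have hnorm : ∀ v : Metric.sphere (0 : E3) 1, ‖(s : ℝ) • (v : E3)‖ = s := fun v => by
      simp [norm_smul]
    simp only [hnorm]
    -- The zero vector has no direction to project on, but then the integrand does not depend on
    -- `t`.
    rcases eq_or_ne x 0 with rfl | hx
    · simp
      ring
    · have hx' := norm_ne_zero_iff.2 hx
      have he : ‖(‖x‖⁻¹ • x : E3)‖ = 1 := by
        rw [norm_smul, norm_inv, norm_norm, inv_mul_cancel₀ hx']
      rw [← integral_sphereUniform_inner he (φ := fun t => K ‖x‖ s (‖x‖ * s * t))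
        (hK.comp (by fun_prop : Continuous fun t : ℝ => (‖x‖, (s : ℝ), ‖x‖ * s * t)))]
      congr 1
      ext v
      rw [real_inner_smul_right, real_inner_smul_right, real_inner_comm]
      congr 1
      field_simp
  rw [integral_prod _ (Integrable.of_bound hcont.aestronglyMeasurable C
    (Filter.Eventually.of_forall fun p => hC _ _ _))]
  rw [integral_isotropicLift μ (hcont.stronglyMeasurable.integral_prod_right) (C := C)]
  · congr 1
    ext r
    simp only [inner_integral]
    simp [norm_smul]
  · intro x
    refine (norm_integral_le_of_norm_le_const (C := C)
      (Filter.Eventually.of_forall fun y => hC _ _ _)).trans_eq ?_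
    simp

/-! ### The wrapping identity on class functions -/

/-- Averaging `j · (F ∘ cos)` over the length of `x + y` agrees with averaging `F` over the half-trace
of `exp x * exp y`, when `|x| = r`, `|y| = s` and the cosine `t` of the angle is uniform. -/
theorem integral_sinc_mul_comp_cos {F : ℝ → ℝ} (hF : Continuous F) {r s : ℝ} (hr : 0 ≤ r)
    (hs : 0 ≤ s) :
    ∫ t in (-1 : ℝ)..1, Real.sinc √(r ^ 2 + s ^ 2 + 2 * (r * s * t)) *
        F (Real.cos √(r ^ 2 + s ^ 2 + 2 * (r * s * t))) =
      ∫ t in (-1 : ℝ)..1, Real.sinc r * Real.sinc s *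
        F (Real.cos r * Real.cos s - Real.sin r * Real.sin s * t) := by
  -- If a length vanishes, both integrands are the same constant in `t`.
  rcases hr.eq_or_lt with rfl | hr
  · simp [Real.sqrt_sq hs]
  rcases hs.eq_or_lt with rfl | hs
  · simp [Real.sqrt_sq hr.le]
  -- Composed with cos R on the left and with the half-trace on the right, this single function is
  -- an antiderivative of both integrands.
  let H : ℝ → ℝ := fun c => -(∫ w in (0 : ℝ)..c, F w) / (r * s)
  have hH : ∀ c, HasDerivAt H (-F c / (r * s)) c := fun c =>
    ((hF.integral_hasStrictDerivAt 0 c).hasDerivAt.neg).div_const _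
  have hHc : Continuous H := continuous_iff_continuousAt.2 fun c => (hH c).continuousAt
  have hrs : r * s ≠ 0 := (mul_pos hr hs).ne'
  -- Only interior derivatives are required on the left: when r = s the square root vanishes at t =
  -- -1 and is not differentiable there.
  rw [intervalIntegral.integral_eq_sub_of_hasDerivAt_of_le (by norm_num)
      (f := fun t => H (Real.cos √(r ^ 2 + s ^ 2 + 2 * (r * s * t)))),
    intervalIntegral.integral_eq_sub_of_hasDerivAt
      (f := fun t => H (Real.cos r * Real.cos s - Real.sin r * Real.sin s * t))]
  -- At t = ±1 the length is r + s or |r - s|, and the addition formulas identify the endpoint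
  -- values.
  · have h1 : r ^ 2 + s ^ 2 + 2 * (r * s * 1) = (r + s) ^ 2 := by ring
    have h2 : r ^ 2 + s ^ 2 + 2 * (r * s * -1) = (r - s) ^ 2 := by ring
    simp only [h1, h2, Real.sqrt_sq_eq_abs, Real.cos_abs, Real.cos_add, Real.cos_sub]
    ring_nf
  · intro t _
    have h1 : HasDerivAt (fun t => Real.cos r * Real.cos s - Real.sin r * Real.sin s * t)
        (-(Real.sin r * Real.sin s)) t := by
      simpa using ((hasDerivAt_id t).const_mul (Real.sin r * Real.sin s)).const_sub
        (Real.cos r * Real.cos s)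
    refine ((hH _).comp t h1).congr_deriv ?_
    rw [Real.sinc_of_ne_zero hr.ne', Real.sinc_of_ne_zero hs.ne']
    field_simp
  · exact (Continuous.intervalIntegrable (by fun_prop) _ _)
  · exact (hHc.comp (by fun_prop)).continuousOn
  · intro t ht
    have hpos : 0 < r ^ 2 + s ^ 2 + 2 * (r * s * t) := by
      nlinarith [mul_pos (mul_pos hr hs) (by linarith [ht.1] : 0 < t + 1), sq_nonneg (r - s)]
    set R := √(r ^ 2 + s ^ 2 + 2 * (r * s * t)) with hR
    have hR0 : R ≠ 0 := (Real.sqrt_pos.2 hpos).ne'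
    have h1 : HasDerivAt (fun t => r ^ 2 + s ^ 2 + 2 * (r * s * t)) (2 * (r * s)) t := by
      simpa using (((hasDerivAt_id t).const_mul (r * s)).const_mul 2).const_add (r ^ 2 + s ^ 2)
    refine ((hH _).comp t (h1.sqrt hpos.ne').cos).congr_deriv ?_
    rw [← hR, Real.sinc_of_ne_zero hR0]
    field_simp
  · have := Real.continuous_sinc
    exact (Continuous.intervalIntegrable (by fun_prop) _ _)

theorem SU2.trace_eq (g : SU2) : g.1.trace = (2 * (g.1 0 0).re : ℝ) := by
  rw [Matrix.trace_fin_two, SU2.apply_one_one, Complex.star_def, Complex.add_conj]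

theorem SU2.abs_re_le (g : SU2) : |(g.1 0 0).re| ≤ 1 :=
  (Complex.abs_re_le_norm _).trans
    (entry_norm_bound_of_unitary (Matrix.mem_specialUnitaryGroup_iff.1 g.2).1 0 0)

theorem angle_smul_torusGen {t : ℝ} (ht : 0 ≤ t) : angle (t • torusGen) = t := by
  rw [angle]
  change √((t • (!![Complex.I, 0; 0, -Complex.I] : Matrix (Fin 2) (Fin 2) ℂ)).det.re) = t
  rw [Matrix.det_fin_two]
  simp [Real.sqrt_mul_self ht]

/-- A continuous class function on SU(2) is a bounded continuous function of half the trace. -/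
theorem exists_continuous_eq_comp_re {f : SU2 → ℝ} (hf : Continuous f)
    (hcl : ∀ k g : SU2, f (k * g * k⁻¹) = f g) :
    ∃ F : ℝ → ℝ, Continuous F ∧ (∃ C, ∀ c, ‖F c‖ ≤ C) ∧ ∀ g : SU2, f g = F (g.1 0 0).re := by
  obtain ⟨C, hC⟩ := isCompact_univ.exists_bound_of_continuousOn hf.continuousOn
  -- `Real.arccos` is constant beyond each end of [-1, 1], so F is continuous and bounded on the
  -- whole line.
  refine ⟨fun c => f (expSU2 (Real.arccos c • torusGen)), ?_, ⟨C, fun c => hC _ trivial⟩, fun g => ?_⟩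
  · exact hf.comp (continuous_expSU2.comp (Real.continuous_arccos.smul continuous_const))
  · refine class_function_eq_of_trace_eq hcl ?_
    have := abs_le.1 g.abs_re_le
    rw [trace_expSU2, angle_smul_torusGen (Real.arccos_nonneg _), Real.cos_arccos this.1 this.2,
      g.trace_eq]

theorem sinc_mul_self (x : ℝ) : Real.sinc x * x = Real.sin x := by
  by_cases h : x = 0
  · simp [h]
  · rw [Real.sinc_of_ne_zero h, div_mul_cancel₀ _ h]

theorem integral_wrap_class_function {ι : E3 ≃ₗ[ℝ] su2} (hι : IsAdInvariant ι) (μ ν : Measure ℝ≥0)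
    [IsProbabilityMeasure μ] [IsProbabilityMeasure ν] {f : SU2 → ℝ} (hf : Continuous f)
    (hcl : ∀ k g : SU2, f (k * g * k⁻¹) = f g) :
    ∫ p, jFun (ι (p.1 + p.2)) * f (expSU2 (ι (p.1 + p.2)))
        ∂(isotropicLift μ).prod (isotropicLift ν) =
      ∫ p, jFun (ι p.1) * jFun (ι p.2) * f (expSU2 (ι p.1) * expSU2 (ι p.2))
        ∂(isotropicLift μ).prod (isotropicLift ν) := by
  obtain ⟨κ, hκ0, hκ⟩ := hι.exists_angle_eq
  obtain ⟨F, hF, ⟨C, hC⟩, hfF⟩ := exists_continuous_eq_comp_re hf hcl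
  have hsinc := Real.continuous_sinc
  have hexp : ∀ x, ((expSU2 (ι x)).1 0 0).re = Real.cos (κ * ‖x‖) := by
    intro x
    have h := (expSU2 (ι x)).trace_eq.symm.trans (trace_expSU2 _)
    rw [Complex.ofReal_inj, hκ] at h
    linarith
  have hmul : ∀ x y, ((expSU2 (ι x) * expSU2 (ι y)).1 0 0).re =
      Real.cos (κ * ‖x‖) * Real.cos (κ * ‖y‖) -
        Real.sinc (κ * ‖x‖) * Real.sinc (κ * ‖y‖) * (κ ^ 2 * inner ℝ x y) := by
    intro x y
    have h := (expSU2 (ι x) * expSU2 (ι y)).trace_eq.symm.trans (trace_expSU2_mul_expSU2 _ _)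
    rw [trace_mul_eq_inner hκ, hκ, hκ, ← Complex.ofReal_mul, ← Complex.ofReal_add,
      Complex.ofReal_inj] at h
    linarith
  have hnorm : ∀ x y : E3, κ * ‖x + y‖ =
      √((κ * ‖x‖) ^ 2 + (κ * ‖y‖) ^ 2 + 2 * (κ ^ 2 * inner ℝ x y)) := by
    intro x y
    rw [← Real.sqrt_sq (by positivity : 0 ≤ κ * ‖x + y‖), mul_pow, norm_add_sq_real]
    congr 1
    ring
  -- The kernel stays continuous and bounded for all real arguments because `√` is zero on negative
  -- numbers.
  have hleft := integral_isotropicLift_prod μ ν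
    (K := fun a b c => Real.sinc √((κ * a) ^ 2 + (κ * b) ^ 2 + 2 * (κ ^ 2 * c)) *
      F (Real.cos √((κ * a) ^ 2 + (κ * b) ^ 2 + 2 * (κ ^ 2 * c)))) (by fun_prop) (C := 1 * C)
    (fun a b c => by
      rw [norm_mul]
      exact mul_le_mul (Real.abs_sinc_le_one _) (hC _) (norm_nonneg _) zero_le_one)
  have hright := integral_isotropicLift_prod μ ν
    (K := fun a b c => Real.sinc (κ * a) * Real.sinc (κ * b) *
      F (Real.cos (κ * a) * Real.cos (κ * b) - Real.sinc (κ * a) * Real.sinc (κ * b) * (κ ^ 2 * c)))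
    (by fun_prop) (C := 1 * 1 * C)
    (fun a b c => by
      rw [norm_mul, norm_mul]
      exact mul_le_mul (mul_le_mul (Real.abs_sinc_le_one _) (Real.abs_sinc_le_one _)
        (norm_nonneg _) zero_le_one) (hC _) (norm_nonneg _) (by norm_num))
  simp only [hfF, jFun_eq_sinc_angle, hκ, hexp, hmul]
  simp only [hnorm]
  refine hleft.trans (Eq.trans ?_ hright.symm)
  congr 1
  ext r
  congr 1
  ext s
  congr 1
  have := integral_sinc_mul_comp_cos hF (r := κ * r) (s := κ * s) (by positivity) (by positivity)
  refine Eq.trans (Eq.trans ?_ this) ?_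
  · congr 1
    ext t
    rw [show κ ^ 2 * (r * s * t) = κ * r * (κ * s) * t by ring]
  · congr 1
    ext t
    rw [← sinc_mul_self (κ * r), ← sinc_mul_self (κ * s)]
    congr 3
    ring

/-! ### Averaging over conjugations -/

/-- The average of a function over conjugacy classes. -/
noncomputable def classAverage (f : SU2 → ℝ) (g : SU2) : ℝ :=
  ∫ k, f (k⁻¹ * g * k) ∂(Measure.haarMeasure (⊤ : TopologicalSpace.PositiveCompacts SU2))

instance instIsProbabilityMeasureHaarSU2 : IsProbabilityMeasure
    (Measure.haarMeasure (⊤ : TopologicalSpace.PositiveCompacts SU2)) :=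
  ⟨by simpa using Measure.haarMeasure_self (K₀ := (⊤ : TopologicalSpace.PositiveCompacts SU2))⟩

/-- Left invariance of Haar measure absorbs `k`. -/
theorem classAverage_conj (f : SU2 → ℝ) (k g : SU2) :
    classAverage f (k * g * k⁻¹) = classAverage f g := by
  rw [classAverage, classAverage, ← integral_mul_left_eq_self _ k]
  congr 1
  ext h
  congr 1
  group

theorem continuous_classAverage {f : SU2 → ℝ} (hf : Continuous f) : Continuous (classAverage f) := by
  have := continuous_parametric_integral_of_continuous
    (μ := Measure.haarMeasure (⊤ : TopologicalSpace.PositiveCompacts SU2))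
    (f := fun g k : SU2 => f (k⁻¹ * g * k)) (by fun_prop) isCompact_univ
  simp only [Measure.restrict_univ] at this
  exact this

/-- After Fubini, for each fixed `k` the map `a` realising conjugation by k⁻¹ preserves ρ and the
weight, so the inner integral does not depend on `k`. -/
theorem integral_classAverage {Z : Type*} [MeasurableSpace Z] {ρ : Measure Z} [IsFiniteMeasure ρ]
    {f : SU2 → ℝ} (hf : Continuous f) {w : Z → ℝ} (hw : Measurable w) (hw1 : ∀ z, ‖w z‖ ≤ 1)
    {T : Z → SU2} (hT : Measurable T)
    (hinv : ∀ k : SU2, ∃ a : Z → Z, MeasurePreserving a ρ ρ ∧ (∀ z, w (a z) = w z) ∧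
      ∀ z, T (a z) = k * T z * k⁻¹) :
    ∫ z, w z * classAverage f (T z) ∂ρ = ∫ z, w z * f (T z) ∂ρ := by
  obtain ⟨C, hC⟩ := isCompact_univ.exists_bound_of_continuousOn hf.continuousOn
  have hm : Measurable fun p : Z × SU2 => w p.1 * f (p.2⁻¹ * T p.1 * p.2) := by
    have := hf.measurable
    fun_prop
  simp only [classAverage, ← integral_const_mul]
  rw [integral_integral_swap]
  · rw [integral_congr_ae (g := fun _ => ∫ z, w z * f (T z) ∂ρ)]
    · simp
    · refine Filter.Eventually.of_forall fun k => ?_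
      obtain ⟨a, ha, haw, haT⟩ := hinv k⁻¹
      have hwf : Measurable fun z => w z * f (T z) := hw.mul (hf.measurable.comp hT)
      have := integral_map (μ := ρ) ha.measurable.aemeasurable (f := fun z => w z * f (T z))
        hwf.aestronglyMeasurable
      rw [ha.map_eq] at this
      simpa only [haw, haT, inv_inv] using this.symm
  · refine Integrable.of_bound (C := 1 * C) hm.aestronglyMeasurable
      (Filter.Eventually.of_forall fun p => ?_)
    simp only [Function.uncurry, norm_mul]
    exact mul_le_mul (hw1 _) (hC _ trivial) (norm_nonneg _) zero_le_one

/-! ### Identifying signed measures by continuous test functions -/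

/-- Adding 1 to a density with values in [-1, 1] makes it nonnegative, which reduces the claim to
finite positive measures without a Jordan decomposition. -/
theorem withDensityᵥ_map_eq_of_forall_integral_eq {Z S : Type*} [MeasurableSpace Z]
    [TopologicalSpace S] [MeasurableSpace S] [BorelSpace S] [HasOuterApproxClosed S]
    {ρ : Measure Z} [IsFiniteMeasure ρ] {w₁ w₂ : Z → ℝ} (hw₁ : Measurable w₁) (hw₂ : Measurable w₂)
    (hb₁ : ∀ z, ‖w₁ z‖ ≤ 1) (hb₂ : ∀ z, ‖w₂ z‖ ≤ 1) {T₁ T₂ : Z → S} (hT₁ : Measurable T₁)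
    (hT₂ : Measurable T₂)
    (h : ∀ f : S → ℝ, Continuous f → ∫ z, w₁ z * f (T₁ z) ∂ρ = ∫ z, w₂ z * f (T₂ z) ∂ρ) :
    (ρ.withDensityᵥ w₁).map T₁ = (ρ.withDensityᵥ w₂).map T₂ := by
  have hi : ∀ w : Z → ℝ, Measurable w → (∀ z, ‖w z‖ ≤ 1) → Integrable w ρ := fun w hw hb =>
    Integrable.of_bound hw.aestronglyMeasurable 1 (Filter.Eventually.of_forall hb)
  have hfin : ∀ w : Z → ℝ, Measurable w → (∀ z, ‖w z‖ ≤ 1) →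
      IsFiniteMeasure (ρ.withDensity fun z => ENNReal.ofReal (1 + w z)) := fun w hw hb =>
    isFiniteMeasure_withDensity_ofReal ((integrable_const 1).add (hi w hw hb)).2
  have hpos : ∀ w : Z → ℝ, (∀ z, ‖w z‖ ≤ 1) → ∀ z, 0 ≤ 1 + w z := fun w hb z => by
    linarith [(abs_le.1 (hb z)).1]
  have := hfin w₁ hw₁ hb₁
  have := hfin w₂ hw₂ hb₂
  have hint : ∀ w : Z → ℝ, Measurable w → (∀ z, ‖w z‖ ≤ 1) → ∀ T : Z → S, Measurable T →
      ∀ f : BoundedContinuousFunction S ℝ,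
      ∫ s, f s ∂((ρ.withDensity fun z => ENNReal.ofReal (1 + w z)).map T) =
        ∫ s, f s ∂(ρ.map T) + ∫ z, w z * f (T z) ∂ρ := by
    intro w hw hb T hT f
    have hfT : Integrable (fun z => f (T z)) ρ :=
      Integrable.of_bound (f.continuous.measurable.comp hT).aestronglyMeasurable ‖f‖
        (Filter.Eventually.of_forall fun z => f.norm_coe_le_norm _)
    rw [integral_map hT.aemeasurable f.continuous.aestronglyMeasurable,
      integral_map hT.aemeasurable f.continuous.aestronglyMeasurable,
      integral_withDensity_eq_integral_toReal_smul (by fun_prop)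
        (Filter.Eventually.of_forall fun z => ENNReal.ofReal_lt_top),
      ← integral_add hfT (hfT.bdd_mul hw.aestronglyMeasurable (Filter.Eventually.of_forall hb))]
    congr 1
    ext z
    rw [ENNReal.toReal_ofReal (hpos w hb z), smul_eq_mul]
    ring
  -- Each shift adds a pushforward of ρ; placing the opposite pushforward on each side balances them
  -- without subtracting measures.
  have key : (ρ.withDensity fun z => ENNReal.ofReal (1 + w₁ z)).map T₁ + ρ.map T₂ =
      (ρ.withDensity fun z => ENNReal.ofReal (1 + w₂ z)).map T₂ + ρ.map T₁ := by
    refine ext_of_forall_integral_eq_of_IsFiniteMeasure fun f => ?_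
    rw [integral_add_measure (f.integrable _) (f.integrable _),
      integral_add_measure (f.integrable _) (f.integrable _), hint w₁ hw₁ hb₁ T₁ hT₁ f,
      hint w₂ hw₂ hb₂ T₂ hT₂ f, h f f.continuous]
    ring
  have hset : ∀ w : Z → ℝ, Measurable w → (∀ z, ‖w z‖ ≤ 1) → ∀ T : Z → S, Measurable T →
      ∀ s, MeasurableSet s →
      ((ρ.withDensity fun z => ENNReal.ofReal (1 + w z)).map T).real s =
        (ρ.map T).real s + (ρ.withDensityᵥ w).map T s := by
    intro w hw hb T hT s hs
    rw [VectorMeasure.map_apply _ hT hs, withDensityᵥ_apply (hi w hw hb) (hT hs),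
      map_measureReal_apply hT hs, map_measureReal_apply hT hs, measureReal_def,
      withDensity_apply _ (hT hs), ← integral_eq_lintegral_of_nonneg_ae
        (Filter.Eventually.of_forall (hpos w hb)) (by fun_prop),
      integral_add (integrable_const _).integrableOn (hi w hw hb).integrableOn]
    simp
  ext s hs
  have hs' := congrArg (fun m : Measure S => m.real s) key
  rw [measureReal_add_apply, measureReal_add_apply] at hs'
  rw [hset w₁ hw₁ hb₁ T₁ hT₁ s hs, hset w₂ hw₂ hb₂ T₂ hT₂ s hs] at hs'
  linarith

/-! ### Wraps of convolutions and convolutions of wraps -/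

theorem measurable_jFun_comp (ι : E3 ≃ₗ[ℝ] su2) : Measurable fun x => jFun (ι x) :=
  (continuous_jFun.comp
    (LinearMap.continuous_of_finiteDimensional (ι : E3 →ₗ[ℝ] su2))).measurable

theorem norm_jFun_le (X : su2) : ‖jFun X‖ ≤ 1 := Real.abs_sinc_le_one _

theorem jFun_Ad (g : SU2) (X : su2) : jFun (Ad g X) = jFun X := by
  rw [jFun_eq_sinc_angle, jFun_eq_sinc_angle, angle_Ad]

/-- Together with `signedConv_wrap`, this presents both sides of the wrapping identity as
pushforwards from the same product space. -/
theorem wrap_conv (ι : E3 ≃ₗ[ℝ] su2) (ν₁ ν₂ : Measure E3) [IsProbabilityMeasure ν₁]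
    [IsProbabilityMeasure ν₂] :
    wrap ι (ν₁ ∗ ν₂) = ((ν₁.prod ν₂).withDensityᵥ fun p => jFun (ι (p.1 + p.2))).map
      fun p => expSU2 (ι (p.1 + p.2)) := by
  have hadd : Measurable fun p : E3 × E3 => p.1 + p.2 := by fun_prop
  have hT : Measurable fun p : E3 × E3 => expSU2 (ι (p.1 + p.2)) := (measurable_exp_comp ι).comp hadd
  have hj : Measurable fun p : E3 × E3 => jFun (ι (p.1 + p.2)) :=
    (measurable_jFun_comp ι).comp hadd
  ext s hs
  rw [wrap_apply ι _ hs, VectorMeasure.map_apply _ hT hs, withDensityᵥ_apply _ (hT hs), Measure.conv]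
  · exact setIntegral_map (measurable_exp_comp ι hs)
      (measurable_jFun_comp ι).aestronglyMeasurable hadd.aemeasurable
  · exact Integrable.of_bound hj.aestronglyMeasurable 1
      (Filter.Eventually.of_forall fun p => norm_jFun_le _)

theorem signedConv_wrap (ι : E3 ≃ₗ[ℝ] su2) (ν₁ ν₂ : Measure E3) [IsProbabilityMeasure ν₁]
    [IsProbabilityMeasure ν₂] :
    signedConv (wrap ι ν₁) (wrap ι ν₂) =
      ((ν₁.prod ν₂).withDensityᵥ fun p => jFun (ι p.1) * jFun (ι p.2)).map
        fun p => expSU2 (ι p.1) * expSU2 (ι p.2) := by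
  have hT : Measurable fun p : E3 × E3 => (expSU2 (ι p.1), expSU2 (ι p.2)) :=
    ((measurable_exp_comp ι).comp measurable_fst).prodMk
      ((measurable_exp_comp ι).comp measurable_snd)
  have hmul : Measurable fun p : SU2 × SU2 => p.1 * p.2 := measurable_fst.mul measurable_snd
  have hi : Integrable (fun p : E3 × E3 => jFun (ι p.1) * jFun (ι p.2)) (ν₁.prod ν₂) :=
    (integrable_jFun ι ν₁).mul_prod (integrable_jFun ι ν₂)
  have hprod : VectorMeasure.prod (wrap ι ν₁) (wrap ι ν₂) (ContinuousLinearMap.mul ℝ ℝ) =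
      ((ν₁.prod ν₂).withDensityᵥ fun p => jFun (ι p.1) * jFun (ι p.2)).map
        fun p => (expSU2 (ι p.1), expSU2 (ι p.2)) := by
    -- Rectangles suffice, and on them the integral of j(x) j(y) factors.
    refine VectorMeasure.prod_eq_of_forall_apply_prod fun s t hs ht => ?_
    rw [VectorMeasure.map_apply _ hT (hs.prod ht), withDensityᵥ_apply hi (hT (hs.prod ht)),
      wrap_apply ι _ hs, wrap_apply ι _ ht, ContinuousLinearMap.mul_apply', ← setIntegral_prod_mul]
    rfl
  rw [signedConv, hprod]
  ext s hs
  rw [VectorMeasure.map_apply _ hmul hs, VectorMeasure.map_apply _ hT (hmul hs)]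
  exact (VectorMeasure.map_apply _ (hmul.comp hT) hs).symm

/-- The wrapping map turns the convolution of isotropic laws into convolution on SU(2). -/
theorem wrap_conv_isotropicLift {ι : E3 ≃ₗ[ℝ] su2} (hι : IsAdInvariant ι) (μ ν : Measure ℝ≥0)
    [IsProbabilityMeasure μ] [IsProbabilityMeasure ν] :
    wrap ι (isotropicLift μ ∗ isotropicLift ν) =
      signedConv (wrap ι (isotropicLift μ)) (wrap ι (isotropicLift ν)) := by
  have hadd : Measurable fun p : E3 × E3 => p.1 + p.2 := by fun_prop
  have hT₁ := (measurable_exp_comp ι).comp hadd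
  have hT₂ : Measurable fun p : E3 × E3 => expSU2 (ι p.1) * expSU2 (ι p.2) :=
    ((measurable_exp_comp ι).comp measurable_fst).mul ((measurable_exp_comp ι).comp measurable_snd)
  have hw₁ := (measurable_jFun_comp ι).comp hadd
  have hw₂ : Measurable fun p : E3 × E3 => jFun (ι p.1) * jFun (ι p.2) :=
    ((measurable_jFun_comp ι).comp measurable_fst).mul
      ((measurable_jFun_comp ι).comp measurable_snd)
  have hb₂ : ∀ p : E3 × E3, ‖jFun (ι p.1) * jFun (ι p.2)‖ ≤ 1 := fun p => by
    rw [norm_mul]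
    exact mul_le_one₀ (norm_jFun_le _) (norm_nonneg _) (norm_jFun_le _)
  have hpres : ∀ A : E3 ≃ₗᵢ[ℝ] E3, MeasurePreserving (Prod.map A A)
      ((isotropicLift μ).prod (isotropicLift ν)) ((isotropicLift μ).prod (isotropicLift ν)) := by
    intro A
    have hA : Measurable A := by fun_prop
    exact MeasurePreserving.prod ⟨hA, isotropicLift_map μ A⟩ ⟨hA, isotropicLift_map ν A⟩
  rw [wrap_conv, signedConv_wrap]
  refine withDensityᵥ_map_eq_of_forall_integral_eq hw₁ hw₂ (fun p => norm_jFun_le _) hb₂ hT₁ hT₂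
    fun f hf => ?_
  -- One isometry applied to both vectors conjugates exp(x + y), by linearity, and equally exp x ·
  -- exp y in `h₂`.
  have h₁ := integral_classAverage (ρ := (isotropicLift μ).prod (isotropicLift ν)) hf hw₁
    (fun p => norm_jFun_le _) hT₁ fun k => by
      obtain ⟨A, hA⟩ := hι.exists_isometry k
      refine ⟨Prod.map A A, hpres A, fun p => ?_, fun p => ?_⟩
      · simp only [Function.comp, Prod.map_fst, Prod.map_snd, ← map_add A, hA, jFun_Ad]
      · simp only [Function.comp, Prod.map_fst, Prod.map_snd, ← map_add A, hA, expSU2_Ad]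
  have h₂ := integral_classAverage (ρ := (isotropicLift μ).prod (isotropicLift ν)) hf hw₂ hb₂ hT₂
    fun k => by
      obtain ⟨A, hA⟩ := hι.exists_isometry k
      refine ⟨Prod.map A A, hpres A, fun p => ?_, fun p => ?_⟩
      · simp only [Prod.map_fst, Prod.map_snd, hA, jFun_Ad]
      · simp only [Prod.map_fst, Prod.map_snd, hA, expSU2_Ad]
        group
  rw [← h₂]
  exact h₁.symm.trans (integral_wrap_class_function hι μ ν (continuous_classAverage hf)
    (classAverage_conj f))

theorem map_map_nnnorm {Ω : Type*} [MeasurableSpace Ω] (P : Measure Ω) {X : Ω → E3}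
    (hX : Measurable X) : (P.map X).map (fun x => ‖x‖₊) = radialLaw P X := by
  rw [Measure.map_map measurable_nnnorm hX]
  rfl

/-- The law of a spherically symmetric vector is the isotropic lift of its radial law. -/
theorem isotropicLift_radialLaw {Ω : Type*} [MeasurableSpace Ω] (P : Measure Ω)
    [IsProbabilityMeasure P] {X : Ω → E3} (hX : Measurable X) (hXs : IsSphericallySymmetric P X) :
    isotropicLift (radialLaw P X) = P.map X := by
  have := Measure.isProbabilityMeasure_map (μ := P) hX.aemeasurable
  rw [← map_map_nnnorm P hX, isotropicLift_map_nnnorm hXs]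

end SU2Wrapping

open SU2Wrapping
/-- Sums of independent spherically symmetric random vectors in `ℝ³ ≅ su(2)` wrap to convolution
products on SU(2). -/
theorem proposition4 {Ω : Type*} [MeasurableSpace Ω] (P : Measure Ω) [IsProbabilityMeasure P]
    (ι : E3 ≃ₗ[ℝ] su2) (hι : IsAdInvariant ι)
    (X Y : Ω → E3) (hX : Measurable X) (hY : Measurable Y) (hXY : IndepFun X Y P)
    (hXs : IsSphericallySymmetric P X) (hYs : IsSphericallySymmetric P Y)
    (μX μY : Measure ℝ≥0) (hμX : radialLaw P X = μX) (hμY : radialLaw P Y = μY) :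
    radialLaw P (fun ω => X ω + Y ω) = radialConv μX μY ∧
    wrap ι (P.map fun ω => X ω + Y ω) = radialWrap ι (radialConv μX μY) ∧
    radialWrap ι (radialLaw P fun ω => X ω + Y ω) = radialWrap ι (radialConv μX μY) ∧
    radialWrap ι (radialConv μX μY) = signedConv (radialWrap ι μX) (radialWrap ι μY) := by
  have hprobX : IsProbabilityMeasure μX := by
    rw [← hμX]
    exact Measure.isProbabilityMeasure_map (measurable_nnnorm.comp hX).aemeasurable
  have hprobY : IsProbabilityMeasure μY := by
    rw [← hμY]
    exact Measure.isProbabilityMeasure_map (measurable_nnnorm.comp hY).aemeasurable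
  -- Independence gives the convolution of the two laws; spherical symmetry identifies each with an
  -- isotropic lift.
  have hlaw : P.map (fun ω => X ω + Y ω) = isotropicLift μX ∗ isotropicLift μY := by
    rw [← hμX, ← hμY, isotropicLift_radialLaw P hX hXs, isotropicLift_radialLaw P hY hYs]
    exact hXY.map_add_eq_map_conv_map hX hY
  have hradial : radialLaw P (fun ω => X ω + Y ω) = radialConv μX μY := by
    rw [← map_map_nnnorm P (X := fun ω => X ω + Y ω) (hX.add hY), hlaw, radialConv]
  refine ⟨hradial, ?_, by rw [hradial], ?_⟩
  · rw [hlaw, radialWrap, isotropicLift_radialConv]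
  · rw [radialWrap, isotropicLift_radialConv]
    exact wrap_conv_isotropicLift hι μX μY
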